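/- Let $X$ be a separable metric space. A \emph{dyadic subbase} of a space is a subbase $\mathcal S=\{S_{n,i}: n<\omega,\ i<2\}$ of its topology consisting of regular open sets such that $S_{n,1}$ is the exterior of $S_{n,0}$ for every $n<\omega$. For $\sigma\in\{0,1,\bot\}^{\omega}$ put $\mathrm{dom}(\sigma)=\{n:\sigma(n)\neq\bot\}$, $S(\sigma)=\bigcap_{k\in\mathrm{dom}(\sigma)}S_{k,\sigma(k)}$ and $\bar S(\sigma)=\bigcap_{k\in\mathrm{dom}(\sigma)}\mathrm{cl}\,S_{k,\sigma(k)}$. The dyadic subbase $\mathcal S$ is \emph{proper} if $\mathrm{cl}\,S(\sigma)=\bar S(\sigma)$ for every $\sigma$ with finite domain, and \emph{independent} if $S(\sigma)\neq\emptyset$ for every $\sigma$ with finite domain. By the Cantor--Bendixson theorem there is a closed, dense-in-itself set $X^\sharp\subseteq X$ whose complement is at most countable; for example, the perfect kernel of $X$ (its largest closed dense-in-itself subset) is such a set. Let $X^\sharp$ be any such set, and call $G\subseteq X$ \emph{half-clopen} if $G$ is regular open in $X$ and $\mathrm{bd}_X G\subseteq X^\sharp$. Then there is a proper dyadic subbase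 $\mathcal S=\{S_{n,i}:n<\omega,\ i<2\}$ of $X$ consisting of half-clopen sets such that, when $X^\sharp\neq\emptyset$, the traces of its members on $X^\sharp$, apart from trivial pairs $\{\emptyset,X^\sharp\}$, form an independent subbase of $X^\sharp$. Precisely, when $X^\sharp\neq\emptyset$, there is an infinite set $N\subseteq\omega$ such that $\{S_{n,i}\cap X^\sharp:n\in N,\ i<2\}$, with $N$ enumerated increasingly, is an independent subbase of the subspace $X^\sharp$, while for every $n\notin N$ the set $S_{n,0}$ is non-empty and disjoint from $X^\sharp$ and $S_{n,1}\supseteq X^\sharp$. In particular, if $X^\sharp=X\neq\emptyset$, then $N=\omega$ and $\mathcal S$ itself is an independent subbase of $X$. -/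

import Mathlib

open Set

/-- A set is regular open if it is the interior of its closure. -/
def IsRegularOpenSet {X : Type*} [TopologicalSpace X] (G : Set X) : Prop :=
  interior (closure G) = G

/-- A dyadic subbase: a subbase `S n i` (`n < ω`, `i < 2`) of the topology made of regular open
sets, in which `S n 1` is the exterior of `S n 0`. -/
structure IsDyadicSubbase {X : Type*} [t : TopologicalSpace X] (S : ℕ → Fin 2 → Set X) : Prop where
  subbase : t = TopologicalSpace.generateFrom {G | ∃ n i, G = S n i}
  regularOpen : ∀ n i, IsRegularOpenSet (S n i)
  exterior : ∀ n, S n 1 = (closure (S n 0))ᶜ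

/-- Sequences over `{0, 1, ⊥}`, where `none` plays the role of `⊥`. -/
abbrev TernarySeq : Type := ℕ → Option (Fin 2)

/-- The set of `n` with `σ n ≠ ⊥`. -/
def TernarySeq.dom (σ : TernarySeq) : Set ℕ := {n | σ n ≠ none}

/-- `S(σ)`: the intersection of the sets `S k (σ k)` over `k ∈ dom σ`. -/
def dyadicInter {X : Type*} (S : ℕ → Fin 2 → Set X) (σ : TernarySeq) : Set X :=
  ⋂ (k : ℕ) (i : Fin 2) (_ : σ k = some i), S k i

/-- A dyadic subbase is proper if `cl S(σ)` is the intersection of the sets `cl S k (σ k)` over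
`k ∈ dom σ`, for every `σ` with finite domain. -/
structure IsProperDyadicSubbase {X : Type*} [TopologicalSpace X] (S : ℕ → Fin 2 → Set X) : Prop
    extends IsDyadicSubbase S where
  proper : ∀ σ : TernarySeq, σ.dom.Finite →
    closure (dyadicInter S σ) = dyadicInter (fun n i => closure (S n i)) σ

/-- An independent subbase: a dyadic subbase with `S(σ) ≠ ∅` for every `σ` with finite domain. -/
structure IsIndependentSubbase {X : Type*} [TopologicalSpace X] (S : ℕ → Fin 2 → Set X) : Prop
    extends IsDyadicSubbase S where
  independent : ∀ σ : TernarySeq, σ.dom.Finite → (dyadicInter S σ).Nonempty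

/-- `P` is a set as provided by the Cantor-Bendixson theorem: closed, dense in itself, with an at
most countable complement. -/
structure IsCantorBendixsonSet {X : Type*} [TopologicalSpace X] (P : Set X) : Prop where
  perfect : Perfect P
  countable_compl : Pᶜ.Countable

/-- A set is half-clopen relative to `P` if it is regular open and its boundary lies in `P`. -/
def IsHalfClopen {X : Type*} [TopologicalSpace X] (P G : Set X) : Prop :=
  IsRegularOpenSet G ∧ frontier G ⊆ P

open scoped Topology

/-!
The construction first treats the subspace `P`, which has no isolated points, and then pulls the
result back to `X` along a retraction.

On `P`, pairs `T n` are built one after the other. The first `n` pairs cut out finitely many cells.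
Given open sets `U`, `V` with `closure U ⊆ V`, choose two points `p ≠ q` in each cell, with `p ∈ U`
if the cell meets `U`, and with `q ∉ closure U` if the cell is not contained in `closure U`. A
Urysohn function `f` takes the value `0` at all `p` and `1` at all `q`; moreover it is `0` on
`closure U` outside the cells contained in `closure U`, and `1` off `V` outside the cells that miss
`U`. The next pair is `{f < c}`, `{f > c}`, where `c` is not a local extremum value of `f` on any
cell (there are only countably many such values), which makes the family proper, and where `c`
avoids the values of `f` on a prescribed countable set. Both members meet every cell, which gives
independence (`exists_isCellSplitting`). Nevertheless neighbourhoods are generated: a point `x ∈ U`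
lies in a cell contained in `closure U ⊆ V`, or else it lies in `{f < c}`, which sticks out of `V`
only within cells that miss `U`; such a cell does not have `x` in its closure, so by properness it
is disjoint from some earlier member around `x` (`exists_proper_independent`).

Since `Pᶜ` is countable, there is a retraction `r : X → P` that moves each point by at most four
times its distance to `P` (`exists_retraction`). With boundaries in `P` that avoid `r '' Pᶜ`, the
sets `r ⁻¹' T n i` are half-clopen and form a proper family (`isSubbaseAlong_preimage`). Together
with countably many clopen subsets of `Pᶜ`, which generate the neighbourhoods of the points of `Pᶜ`
and whose complements are arbitrarily close to `P` (`exists_clopen_sequence`), they form a subbase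
of `X`; clopen sets do not affect properness, and their traces on `P` are trivial.
-/

/-! ### Cutting a continuous function at a generic value -/

/-- The values that `f` attains as a minimum over some neighbourhood within `D` form a countable
set: each of them is the infimum of `f` over the trace on `D` of a member of a countable base. -/
theorem countable_localMinValues {Z : Type*} [TopologicalSpace Z] [SecondCountableTopology Z]
    {f : Z → ℝ} (hf : Continuous f) (D : Set Z) :
    {c | ∃ x ∈ closure D, f x = c ∧ x ∉ closure (D ∩ {z | f z < c})}.Countable := by
  have hB := TopologicalSpace.isBasis_countableBasis Z
  refine ((TopologicalSpace.countable_countableBasis Z).image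
    (fun B => sInf (f '' (B ∩ D)))).mono ?_
  rintro c ⟨x, hxD, rfl, hx⟩
  obtain ⟨B, hBb, hxB, hBsub⟩ := hB.exists_subset_of_mem_open hx isClosed_closure.isOpen_compl
  have hxBD : x ∈ closure (B ∩ D) :=
    (hB.isOpen hBb).inter_closure ⟨hxB, hxD⟩
  refine ⟨B, hBb, IsGLB.csInf_eq ⟨?_, ?_⟩ ?_⟩
  · rintro _ ⟨z, ⟨hzB, hzD⟩, rfl⟩
    by_contra h
    exact hBsub hzB (subset_closure ⟨hzD, not_le.mp h⟩)
  · intro b hb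
    have : closure (B ∩ D) ⊆ {z | b ≤ f z} :=
      closure_minimal (fun z hz => hb ⟨z, hz, rfl⟩) (isClosed_le continuous_const hf)
    exact this hxBD
  · exact (closure_nonempty_iff.mp ⟨x, hxBD⟩).image f

/-- A continuous function can be cut at a value `c` which is taken nowhere on a given countable
set, and which is not a local extremum value on any of countably many given sets. -/
theorem exists_generic_value {Z : Type*} [TopologicalSpace Z] [SecondCountableTopology Z]
    {f : Z → ℝ} (hf : Continuous f) {Q : Set Z} (hQ : Q.Countable)
    {𝒟 : Set (Set Z)} (h𝒟 : 𝒟.Countable) :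
    ∃ c, 0 < c ∧ c < 1 ∧ (∀ x ∈ Q, f x ≠ c) ∧ ∀ D ∈ 𝒟, ∀ x ∈ closure D, f x = c →
      x ∈ closure (D ∩ {z | f z < c}) ∧ x ∈ closure (D ∩ {z | c < f z}) := by
  have h1 := h𝒟.biUnion fun D _ => countable_localMinValues hf D
  have h2 := h𝒟.biUnion fun D _ =>
    (countable_localMinValues hf.neg D).preimage (neg_injective (G := ℝ))
  obtain ⟨c, hc, hc0, hc1⟩ := (((hQ.image f).union (h1.union h2)).dense_compl ℝ).exists_between
    (zero_lt_one (α := ℝ))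
  simp only [mem_compl_iff, mem_union, not_or, mem_iUnion, not_exists] at hc
  refine ⟨c, hc0, hc1, fun x hx h => hc.1 ⟨x, hx, h⟩, fun D hD x hx hxc => ⟨?_, ?_⟩⟩
  · by_contra h
    exact hc.2.1 D hD ⟨x, hx, hxc, h⟩
  · by_contra h
    refine hc.2.2 D hD ⟨x, hx, by simp [hxc], ?_⟩
    simpa using h

/-! ### Pairs of regular open sets exterior to each other -/

/-- Two sets, each of which is the exterior of the other; both are then regular open. -/
structure IsExteriorPair {Z : Type*} [TopologicalSpace Z] (A : Fin 2 → Set Z) : Prop where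
  one_eq : A 1 = (closure (A 0))ᶜ
  zero_eq : A 0 = (closure (A 1))ᶜ

namespace IsExteriorPair

variable {Z : Type*} [TopologicalSpace Z] {A : Fin 2 → Set Z}

theorem eq_compl (h : IsExteriorPair A) (i : Fin 2) : A (1 - i) = (closure (A i))ᶜ := by
  fin_cases i
  · exact h.one_eq
  · exact h.zero_eq

theorem eq_compl' (h : IsExteriorPair A) (i : Fin 2) : A i = (closure (A (1 - i)))ᶜ := by
  simpa using h.eq_compl (1 - i)

theorem isOpen (h : IsExteriorPair A) (i : Fin 2) : IsOpen (A i) := by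
  rw [h.eq_compl' i]
  exact isClosed_closure.isOpen_compl

theorem isRegularOpenSet (h : IsExteriorPair A) (i : Fin 2) : IsRegularOpenSet (A i) := by
  rw [IsRegularOpenSet, ← compl_compl (closure (A i)), ← h.eq_compl, interior_compl,
    ← h.eq_compl']

theorem disjoint_one_sub (h : IsExteriorPair A) (i : Fin 2) : Disjoint (A i) (A (1 - i)) := by
  rw [h.eq_compl]
  exact disjoint_compl_right.mono_left subset_closure

theorem exists_mem_closure (h : IsExteriorPair A) (x : Z) : ∃ i, x ∈ closure (A i) := by
  by_cases hx : x ∈ closure (A 0)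
  · exact ⟨0, hx⟩
  · exact ⟨1, subset_closure (h.one_eq ▸ hx)⟩

theorem mem_one_sub_of_notMem (h : IsExteriorPair A) {i : Fin 2} {x : Z}
    (hx : x ∉ closure (A i)) : x ∈ A (1 - i) := by
  rwa [h.eq_compl]

theorem isHalfClopen {P : Set Z} (h : IsExteriorPair A) (hP : ∀ i, frontier (A i) ⊆ P) (i : Fin 2) :
    IsHalfClopen P (A i) :=
  ⟨h.isRegularOpenSet i, hP i⟩

end IsExteriorPair

/-! ### One step of the construction -/

/-- A family of cells: finitely many pairwise disjoint non-empty open sets. -/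
structure IsCellFamily {Z : Type*} [TopologicalSpace Z] (𝒞 : Set (Set Z)) : Prop where
  finite : 𝒞.Finite
  isOpen : ∀ C ∈ 𝒞, IsOpen C
  nonempty : ∀ C ∈ 𝒞, C.Nonempty
  disjoint : 𝒞.PairwiseDisjoint id

/-- `A` splits every cell of `𝒞` properly, has no boundary points in `Q`, and handles the
pair `U`, `V`: a point of `U` lies in a cell that is contained in `closure U`, or it lies in `A 0`,
where `A 0` stays within `V` and those cells that miss `U`. -/
structure IsCellSplitting {Z : Type*} [TopologicalSpace Z] (𝒞 : Set (Set Z)) (Q U V : Set Z)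
    (A : Fin 2 → Set Z) : Prop where
  pair : IsExteriorPair A
  frontier_notMem : ∀ i, ∀ x ∈ Q, x ∉ frontier (A i)
  nonempty : ∀ C ∈ 𝒞, ∀ i, (C ∩ A i).Nonempty
  closure_inter : ∀ C ∈ 𝒞, ∀ i, closure C ∩ closure (A i) ⊆ closure (C ∩ A i)
  mem_or : ∀ x ∈ U, (∃ C ∈ 𝒞, x ∈ C ∧ C ⊆ closure U) ∨ x ∈ A 0
  zero_subset : A 0 ⊆ V ∪ ⋃ C ∈ {C ∈ 𝒞 | Disjoint C U}, C

/-- It suffices to find a continuous function with the required values `0` and `1`: the pair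
`{f < c}`, `{c < f}` does it when `c` is generic. -/
theorem exists_isCellSplitting_of_zeroOne {Z : Type*} [TopologicalSpace Z]
    [SecondCountableTopology Z] {𝒞 : Set (Set Z)} (h𝒞 : IsCellFamily 𝒞) {Q : Set Z}
    (hQ : Q.Countable) {U V : Set Z} {f : Z → ℝ} (hf : Continuous f)
    (h0 : ∀ C ∈ 𝒞, ∃ p ∈ C, f p = 0) (h1 : ∀ C ∈ 𝒞, ∃ q ∈ C, f q = 1)
    (hU : ∀ x ∈ U, (∃ C ∈ 𝒞, x ∈ C ∧ C ⊆ closure U) ∨ f x = 0)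
    (hV : ∀ x, x ∉ V → (∃ C ∈ 𝒞, x ∈ C ∧ Disjoint C U) ∨ f x = 1) :
    ∃ A, IsCellSplitting 𝒞 Q U V A := by
  obtain ⟨c, hc0, hc1, hcQ, hc⟩ := exists_generic_value hf hQ (h𝒞.finite.countable.insert univ)
  have cl0 : closure {z | f z < c} = {z | f z ≤ c} := by
    refine subset_antisymm (closure_lt_subset_le hf continuous_const) fun z hz => ?_
    rcases eq_or_lt_of_le (show f z ≤ c from hz) with h | h
    · simpa using (hc univ (mem_insert _ _) z (by simp) h).1
    · exact subset_closure h
  have cl1 : closure {z | c < f z} = {z | c ≤ f z} := by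
    refine subset_antisymm (closure_lt_subset_le continuous_const hf) fun z hz => ?_
    rcases eq_or_lt_of_le (show c ≤ f z from hz) with h | h
    · simpa using (hc univ (mem_insert _ _) z (by simp) h.symm).2
    · exact subset_closure h
  have op0 : IsOpen {z | f z < c} := isOpen_lt hf continuous_const
  have op1 : IsOpen {z | c < f z} := isOpen_lt continuous_const hf
  refine ⟨![{z | f z < c}, {z | c < f z}], ⟨?_, ?_⟩, ?_, ?_, ?_, ?_, ?_⟩
  · simp only [Matrix.cons_val_zero, Matrix.cons_val_one, cl0]
    ext z; simp
  · simp only [Matrix.cons_val_zero, Matrix.cons_val_one, cl1]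
    ext z; simp
  · refine Fin.forall_fin_two.mpr ⟨fun x hx h => hcQ x hx ?_, fun x hx h => hcQ x hx ?_⟩
    · rw [Matrix.cons_val_zero, op0.frontier_eq, cl0] at h
      exact le_antisymm h.1 (not_lt.mp h.2)
    · rw [Matrix.cons_val_one, Matrix.cons_val_zero, op1.frontier_eq, cl1] at h
      exact le_antisymm (not_lt.mp h.2) h.1
  · refine fun C hC => Fin.forall_fin_two.mpr ⟨?_, ?_⟩
    · obtain ⟨p, hp, hfp⟩ := h0 C hC
      exact ⟨p, hp, show f p < c by rwa [hfp]⟩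
    · obtain ⟨q, hq, hfq⟩ := h1 C hC
      exact ⟨q, hq, show c < f q by rwa [hfq]⟩
  · refine fun C hC => Fin.forall_fin_two.mpr ⟨?_, ?_⟩
    · rintro x ⟨hxC, hx⟩
      rw [Matrix.cons_val_zero, cl0] at hx
      rcases eq_or_lt_of_le (show f x ≤ c from hx) with h | h
      · exact (hc C (mem_insert_of_mem _ hC) x hxC h).1
      · exact op0.closure_inter ⟨hxC, h⟩
    · rintro x ⟨hxC, hx⟩
      rw [Matrix.cons_val_one, Matrix.cons_val_zero, cl1] at hx
      rcases eq_or_lt_of_le (show c ≤ f x from hx) with h | h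
      · exact (hc C (mem_insert_of_mem _ hC) x hxC h.symm).2
      · exact op1.closure_inter ⟨hxC, h⟩
  · intro x hx
    exact (hU x hx).imp_right fun h => show f x < c by rwa [h]
  · intro x hx
    have hx : f x < c := hx
    by_contra hn
    simp only [mem_union, mem_iUnion, not_or, not_exists] at hn
    rcases hV x hn.1 with ⟨C, hC, hxC, hd⟩ | h
    · exact hn.2 C ⟨hC, hd⟩ hxC
    · linarith

/-- Every cell gets a point `p` where `f` vanishes and a point `q` where `f` is `1`; apart from
these points, `f` is `0` on `closure U` and `1` off `V`, except on the cells contained in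
`closure U` and on the cells that miss `U`, respectively. -/
theorem exists_isCellSplitting {Z : Type*} [TopologicalSpace Z] [T1Space Z] [NormalSpace Z]
    [SecondCountableTopology Z] [PerfectSpace Z] [Nonempty Z] {𝒞 : Set (Set Z)} (h𝒞 : IsCellFamily 𝒞)
    {Q : Set Z} (hQ : Q.Countable) {U V : Set Z} (hV : IsOpen V)
    (hUV : closure U ⊆ V) :
    ∃ A, IsCellSplitting 𝒞 Q U V A := by
  have hp : ∀ C ∈ 𝒞, ∃ p ∈ C, ¬ Disjoint C U → p ∈ U := by
    intro C hC
    by_cases h : Disjoint C U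
    · obtain ⟨p, hp⟩ := h𝒞.nonempty C hC
      exact ⟨p, hp, fun h' => absurd h h'⟩
    · obtain ⟨p, hpC, hpU⟩ := not_disjoint_iff.mp h
      exact ⟨p, hpC, fun _ => hpU⟩
  choose! p hpC hpU using hp
  have hq : ∀ C ∈ 𝒞, ∃ q ∈ C, q ≠ p C ∧ (¬ C ⊆ closure U → q ∉ closure U) := by
    intro C hC
    have key : ∀ W : Set Z, IsOpen W → W.Nonempty → ∃ q ∈ W, q ≠ p C := by
      rintro W hW ⟨w, hw⟩
      by_cases hwp : w = p C
      · subst hwp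
        obtain ⟨q, hq, hne⟩ := preperfect_iff_nhds.mp PerfectSpace.univ_preperfect _ (mem_univ _)
          W (hW.mem_nhds hw)
        exact ⟨q, hq.1, hne⟩
      · exact ⟨w, hw, hwp⟩
    by_cases h : C ⊆ closure U
    · obtain ⟨q, hq, hne⟩ := key C (h𝒞.isOpen C hC) (h𝒞.nonempty C hC)
      exact ⟨q, hq, hne, fun h' => absurd h h'⟩
    · obtain ⟨q, hq, hne⟩ := key (C \ closure U) ((h𝒞.isOpen C hC).sdiff isClosed_closure)
        (sdiff_nonempty.mpr h)
      exact ⟨q, hq.1, hne, fun _ => hq.2⟩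
  choose! q hqC hqp hqU using hq
  have hopen : ∀ p : Set Z → Prop, IsOpen (⋃ C ∈ {C ∈ 𝒞 | p C}, C) := fun _ =>
    isOpen_biUnion fun C hC => h𝒞.isOpen C hC.1
  have hcell : ∀ C ∈ 𝒞, ∀ C' ∈ 𝒞, ∀ x, x ∈ C → x ∈ C' → C = C' := fun C hC C' hC' x hx hx' =>
    h𝒞.disjoint.elim_set hC hC' x hx hx'
  obtain ⟨f, hf0, hf1, -⟩ := exists_continuous_zero_one_of_isClosed
    (s := (closure U \ ⋃ C ∈ {C ∈ 𝒞 | C ⊆ closure U}, C) ∪ p '' 𝒞)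
    (t := (Vᶜ \ ⋃ C ∈ {C ∈ 𝒞 | Disjoint C U}, C) ∪ q '' 𝒞)
    ((isClosed_closure.sdiff (hopen _)).union (h𝒞.finite.image p).isClosed)
    ((hV.isClosed_compl.sdiff (hopen _)).union (h𝒞.finite.image q).isClosed) (by
      rw [Set.disjoint_left]
      rintro x (⟨hxU, hxn⟩ | ⟨C, hC, rfl⟩) (⟨hxV, hxn'⟩ | ⟨C', hC', hx⟩)
      · exact hxV (hUV hxU)
      · subst hx
        simp only [mem_iUnion, not_exists] at hxn
        exact hqU C' hC' (fun h => hxn C' ⟨hC', h⟩ (hqC C' hC')) hxU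
      · simp only [mem_iUnion, not_exists] at hxn'
        exact hxV (hUV (subset_closure
          (hpU C hC fun h => hxn' C ⟨hC, h⟩ (hpC C hC))))
      · obtain rfl := hcell C hC C' hC' _ (hpC C hC) (hx ▸ hqC C' hC')
        exact hqp C hC hx)
  refine exists_isCellSplitting_of_zeroOne h𝒞 hQ f.continuous
    (fun C hC => ⟨p C, hpC C hC, hf0 (Or.inr ⟨C, hC, rfl⟩)⟩)
    (fun C hC => ⟨q C, hqC C hC, hf1 (Or.inr ⟨C, hC, rfl⟩)⟩) ?_ ?_
  · intro x hx
    by_cases h : x ∈ ⋃ C ∈ {C ∈ 𝒞 | C ⊆ closure U}, C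
    · simp only [mem_iUnion] at h
      obtain ⟨C, hC, hxC⟩ := h
      exact Or.inl ⟨C, hC.1, hxC, hC.2⟩
    · exact Or.inr (hf0 (Or.inl ⟨subset_closure hx, h⟩))
  · intro x hx
    by_cases h : x ∈ ⋃ C ∈ {C ∈ 𝒞 | Disjoint C U}, C
    · simp only [mem_iUnion] at h
      obtain ⟨C, hC, hxC⟩ := h
      exact Or.inl ⟨C, hC.1, hxC, hC.2⟩
    · exact Or.inr (hf1 (Or.inl ⟨hx, h⟩))

/-! ### The independent subbase of a space without isolated points -/

/-- The cells of level `n` of a sequence of pairs: all intersections that take one member from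
each of the first `n` pairs. -/
def levelCells {Z : Type*} (T : ℕ → Fin 2 → Set Z) (n : ℕ) : Set (Set Z) :=
  range fun σ : ℕ → Fin 2 => {x | ∀ k < n, x ∈ T k (σ k)}

theorem levelCells_zero {Z : Type*} (T : ℕ → Fin 2 → Set Z) : levelCells T 0 = {univ} := by
  simp [levelCells]

theorem levelCells_succ {Z : Type*} (T : ℕ → Fin 2 → Set Z) (n : ℕ) :
    levelCells T (n + 1) = image2 (fun C i => C ∩ T n i) (levelCells T n) univ := by
  ext C
  constructor
  · rintro ⟨σ, rfl⟩
    refine ⟨_, ⟨σ, rfl⟩, σ n, mem_univ _, ?_⟩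
    ext x
    simp [Nat.forall_lt_succ_right, -Order.lt_add_one_iff]
  · rintro ⟨_, ⟨σ, rfl⟩, i, -, rfl⟩
    refine ⟨Function.update σ n i, ?_⟩
    ext x
    simp only [mem_ofPred_eq, Nat.forall_lt_succ_right, Function.update_self, mem_inter_iff]
    refine and_congr_left' (forall₂_congr fun k hk => ?_)
    rw [Function.update_of_ne hk.ne]

theorem isCellFamily_univ {Z : Type*} [TopologicalSpace Z] [Nonempty Z] :
    IsCellFamily ({univ} : Set (Set Z)) where
  finite := finite_singleton _
  isOpen := by simp
  nonempty := by simp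
  disjoint := pairwiseDisjoint_singleton _ _

theorem IsCellSplitting.isCellFamily {Z : Type*} [TopologicalSpace Z] {𝒞 : Set (Set Z)}
    {Q U V : Set Z} {A : Fin 2 → Set Z} (hA : IsCellSplitting 𝒞 Q U V A) (h : IsCellFamily 𝒞) :
    IsCellFamily (image2 (fun C i => C ∩ A i) 𝒞 univ) where
  finite := h.finite.image2 _ finite_univ
  isOpen := by
    rintro _ ⟨C, hC, i, -, rfl⟩
    exact (h.isOpen C hC).inter (hA.pair.isOpen i)
  nonempty := by
    rintro _ ⟨C, hC, i, -, rfl⟩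
    exact hA.nonempty C hC i
  disjoint := by
    rintro _ ⟨C, hC, i, -, rfl⟩ _ ⟨C', hC', j, -, rfl⟩ hne
    by_cases hCC : C = C'
    · subst hCC
      have hij : j = 1 - i := by
        have : i ≠ j := by rintro rfl; exact hne rfl
        omega
      subst hij
      exact (hA.pair.disjoint_one_sub i).mono inter_subset_right inter_subset_right
    · exact (h.disjoint hC hC' hCC).mono inter_subset_left inter_subset_left

/-- Iterating `exists_isCellSplitting`: the `n`-th pair splits all cells formed by the previous
pairs and handles `U n`, `V n`. -/
theorem exists_splitting_sequence {Z : Type*} [TopologicalSpace Z] [T1Space Z] [NormalSpace Z]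
    [SecondCountableTopology Z] [PerfectSpace Z] [Nonempty Z] {Q : Set Z} (hQ : Q.Countable)
    {U V : ℕ → Set Z} (hV : ∀ n, IsOpen (V n))
    (hUV : ∀ n, closure (U n) ⊆ V n) :
    ∃ T : ℕ → Fin 2 → Set Z, ∀ n, IsCellFamily (levelCells T n) ∧
      IsCellSplitting (levelCells T n) Q (U n) (V n) (T n) := by
  have step : ∀ (𝒞 : {𝒞 : Set (Set Z) // IsCellFamily 𝒞}) (n : ℕ),
      ∃ A, IsCellSplitting 𝒞.1 Q (U n) (V n) A :=
    fun 𝒞 n => exists_isCellSplitting 𝒞.2 hQ (hV n) (hUV n)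
  choose A hA using step
  let F : ℕ → {𝒞 : Set (Set Z) // IsCellFamily 𝒞} := fun n =>
    Nat.rec ⟨{univ}, isCellFamily_univ⟩ (fun n 𝒞 => ⟨_, (hA 𝒞 n).isCellFamily 𝒞.2⟩) n
  have hF : ∀ n, levelCells (fun n => A (F n) n) n = (F n).1 := by
    intro n
    induction n with
    | zero => exact levelCells_zero _
    | succ n ih => rw [levelCells_succ, ih]
  refine ⟨fun n => A (F n) n, fun n => ?_⟩
  rw [hF n]
  exact ⟨(F n).2, hA (F n) n⟩

/-- Shrinking pairs of basic open sets, listed in a sequence. -/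
theorem exists_shrinking_sequence (Z : Type*) [TopologicalSpace Z] [RegularSpace Z]
    [SecondCountableTopology Z] [Nonempty Z] :
    ∃ U V : ℕ → Set Z, (∀ n, IsOpen (U n)) ∧ (∀ n, IsOpen (V n)) ∧
      (∀ n, closure (U n) ⊆ V n) ∧
      ∀ x W, IsOpen W → x ∈ W → ∃ n, x ∈ U n ∧ V n ⊆ W := by
  have hB := TopologicalSpace.isBasis_countableBasis Z
  let B := TopologicalSpace.countableBasis Z
  let ℬ : Set (Set Z × Set Z) := {p | p ∈ B ×ˢ B ∧ closure p.1 ⊆ p.2}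
  have hc : ℬ.Countable := ((TopologicalSpace.countable_countableBasis Z).prod
    (TopologicalSpace.countable_countableBasis Z)).mono fun p hp => hp.1
  have key : ∀ (x : Z) W, IsOpen W → x ∈ W → ∃ p ∈ ℬ, x ∈ p.1 ∧ p.2 ⊆ W := by
    intro x W hW hx
    obtain ⟨V, hV, hxV, hVW⟩ := hB.exists_subset_of_mem_open hx hW
    obtain ⟨U, hU, hxU, hUV⟩ := hB.exists_closure_subset ((hB.isOpen hV).mem_nhds hxV)
    exact ⟨(U, V), ⟨⟨hU, hV⟩, hUV⟩, hxU, hVW⟩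
  obtain ⟨z⟩ := ‹Nonempty Z›
  obtain ⟨p, hp, -⟩ := key z univ isOpen_univ (mem_univ z)
  obtain ⟨g, hg⟩ := hc.exists_eq_range ⟨p, hp⟩
  have hmem : ∀ n, g n ∈ ℬ := fun n => hg ▸ mem_range_self n
  refine ⟨fun n => (g n).1, fun n => (g n).2, fun n => hB.isOpen (hmem n).1.1,
    fun n => hB.isOpen (hmem n).1.2, fun n => (hmem n).2, fun x W hW hx => ?_⟩
  obtain ⟨p, hp, h⟩ := key x W hW hx
  obtain ⟨n, rfl⟩ := hg ▸ hp
  exact ⟨n, h⟩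

theorem mem_dyadicInter {Z : Type*} {S : ℕ → Fin 2 → Set Z} {σ : TernarySeq} {x : Z} :
    x ∈ dyadicInter S σ ↔ ∀ k i, σ k = some i → x ∈ S k i := by
  simp [dyadicInter]

theorem isDyadicSubbase_of_exterior {Z : Type*} [TopologicalSpace Z] {S : ℕ → Fin 2 → Set Z}
    (hS : ∀ n, IsExteriorPair (S n))
    (h : ∀ x V, IsOpen V → x ∈ V →
      ∃ W, IsOpen[TopologicalSpace.generateFrom {G | ∃ n i, G = S n i}] W ∧ x ∈ W ∧ W ⊆ V) :
    IsDyadicSubbase S where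
  subbase := by
    refine le_antisymm (le_generateFrom ?_) fun V hV => ?_
    · rintro _ ⟨n, i, rfl⟩
      exact (hS n).isOpen i
    · refine (@isOpen_iff_forall_mem_open _ (_) V).mpr fun x hx => ?_
      obtain ⟨W, hW, hxW, hWV⟩ := h x V hV hx
      exact ⟨W, hWV, hW, hxW⟩
  regularOpen n i := (hS n).isRegularOpenSet i
  exterior n := (hS n).one_eq

theorem isProperDyadicSubbase_of_mem_closure {X : Type*} [TopologicalSpace X]
    {S : ℕ → Fin 2 → Set X} (h : IsDyadicSubbase S)
    (hS : ∀ σ : TernarySeq, σ.dom.Finite → ∀ x,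
      (∀ k i, σ k = some i → x ∈ closure (S k i)) → x ∈ closure (dyadicInter S σ)) :
    IsProperDyadicSubbase S where
  toIsDyadicSubbase := h
  proper σ hσ := subset_antisymm
    (fun _ hx => mem_dyadicInter.mpr fun k i hk =>
      closure_mono (fun _ hy => mem_dyadicInter.mp hy k i hk) hx)
    fun x hx => hS σ hσ x fun k i hk => mem_dyadicInter.mp hx k i hk

theorem isOpen_generateFrom_pairs {Z : Type*} (S : ℕ → Fin 2 → Set Z) (n : ℕ) (i : Fin 2) :
    IsOpen[TopologicalSpace.generateFrom {G | ∃ n i, G = S n i}] (S n i) :=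
  TopologicalSpace.isOpen_generateFrom_of_mem ⟨n, i, rfl⟩

theorem isOpen_generateFrom_biInter {Z : Type*} (S : ℕ → Fin 2 → Set Z) {s : Set (ℕ × Fin 2)}
    (hs : s.Finite) :
    IsOpen[TopologicalSpace.generateFrom {G | ∃ n i, G = S n i}] (⋂ p ∈ s, S p.1 p.2) :=
  @Finite.isOpen_biInter _ _ (_) _ _ hs fun p _ => isOpen_generateFrom_pairs S p.1 p.2

theorem TernarySeq.exists_bound {σ : TernarySeq} (hσ : σ.dom.Finite) :
    ∃ n, ∀ k, σ k ≠ none → k < n := by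
  obtain ⟨n, hn⟩ := hσ.bddAbove
  exact ⟨n + 1, fun k hk => Nat.lt_succ_of_le (hn hk)⟩

/-- A non-empty regular second countable space without isolated points has a proper independent
subbase whose members have no boundary points in a given countable set. A point of `U n` lies in a
cell inside `closure (U n)`, or it is separated from `(V n)ᶜ` by `T n 0` together with the earlier
members around it; so the sets `T n i` form a subbase although each of them meets every cell. -/
theorem exists_proper_independent {Z : Type*} [TopologicalSpace Z] [T3Space Z]
    [SecondCountableTopology Z] [PerfectSpace Z] [Nonempty Z] {Q : Set Z} (hQ : Q.Countable) :
    ∃ T : ℕ → Fin 2 → Set Z, (∀ n, IsExteriorPair (T n)) ∧ IsProperDyadicSubbase T ∧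
      IsIndependentSubbase T ∧ ∀ n i, ∀ x ∈ Q, x ∉ frontier (T n i) := by
  obtain ⟨U, V, hU, hV, hUV, hbasis⟩ := exists_shrinking_sequence Z
  obtain ⟨T, hT⟩ := exists_splitting_sequence hQ hV hUV
  have hpair : ∀ n, IsExteriorPair (T n) := fun n => (hT n).2.pair
  have hproper : ∀ (τ : ℕ → Fin 2) (n : ℕ) (x : Z), (∀ k < n, x ∈ closure (T k (τ k))) →
      x ∈ closure {x | ∀ k < n, x ∈ T k (τ k)} := by
    intro τ n x
    induction n with
    | zero => simp
    | succ n ih =>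
      intro h
      refine closure_mono ?_ ((hT n).2.closure_inter _ ⟨τ, rfl⟩ (τ n)
        ⟨ih fun k hk => h k (hk.trans n.lt_succ_self), h n n.lt_succ_self⟩)
      intro y hy
      exact Nat.forall_lt_succ_right.mpr hy
  have hsub : IsDyadicSubbase T := by
    refine isDyadicSubbase_of_exterior hpair fun x W hW hxW => ?_
    obtain ⟨n, hxU, hVW⟩ := hbasis x W hW hxW
    rcases (hT n).2.mem_or x hxU with ⟨_, ⟨σ, rfl⟩, hx, hsubU⟩ | hx0
    · refine ⟨_, ?_, hx, hsubU.trans ((hUV n).trans hVW)⟩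
      convert isOpen_generateFrom_biInter T ((finite_Iio n).image fun k => (k, σ k))
      ext; simp
    -- All members of the first `n` pairs around `x`; a cell of level `n` that misses `U n` does
    -- not have `x` in its closure, so one of these members is disjoint from it.
    · refine ⟨⋂ p ∈ insert (n, 0) {p : ℕ × Fin 2 | p.1 < n ∧ x ∈ T p.1 p.2}, T p.1 p.2,
        isOpen_generateFrom_biInter T (Finite.insert _ ?_), ?_, ?_⟩
      · exact ((finite_Iio n).prod (finite_univ (α := Fin 2))).subset
          fun p hp => ⟨hp.1, mem_univ _⟩
      · rw [biInter_insert]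
        exact ⟨hx0, mem_iInter₂.mpr fun p hp => hp.2⟩
      · rw [biInter_insert]
        rintro y ⟨hy0, hy⟩
        rcases (hT n).2.zero_subset hy0 with hyV | hyC
        · exact hVW hyV
        · simp only [mem_iUnion] at hyC
          obtain ⟨_, ⟨⟨σ, rfl⟩, hd⟩, hyC⟩ := hyC
          have hxC : ¬ ∀ k < n, x ∈ closure (T k (σ k)) := fun h =>
            disjoint_left.mp (hd.closure_left (hU n)) (hproper σ n x h) hxU
          push Not at hxC
          obtain ⟨k, hk, hxk⟩ := hxC
          have hyk : y ∈ T k (1 - σ k) :=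
            mem_iInter₂.mp hy (k, 1 - σ k) ⟨hk, (hpair k).mem_one_sub_of_notMem hxk⟩
          exact absurd hyk (disjoint_left.mp ((hpair k).disjoint_one_sub _) (hyC k hk))
  refine ⟨T, hpair, isProperDyadicSubbase_of_mem_closure hsub fun σ hσ x hx => ?_,
    ⟨hsub, fun σ hσ => ?_⟩, fun n i => (hT n).2.frontier_notMem i⟩
  · obtain ⟨n, hn⟩ := TernarySeq.exists_bound hσ
    -- `σ` extends to a sequence without `⊥` such that `x` stays in the closures of all members.
    have : ∀ k, ∃ i, x ∈ closure (T k i) ∧ ∀ j, σ k = some j → j = i := by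
      intro k
      cases h : σ k with
      | none =>
        obtain ⟨i, hi⟩ := (hpair k).exists_mem_closure x
        exact ⟨i, hi, by simp⟩
      | some i => exact ⟨i, hx k i h, by simp⟩
    choose τ hτ hτσ using this
    refine closure_mono (fun y hy => mem_dyadicInter.mpr fun k i hk => ?_)
      (hproper τ n x fun k _ => hτ k)
    rw [hτσ k i hk]
    exact hy k (hn k (by simp [hk]))
  · obtain ⟨n, hn⟩ := TernarySeq.exists_bound hσ
    obtain ⟨x, hx⟩ := (hT n).1.nonempty _ ⟨fun k => (σ k).getD 0, rfl⟩
    refine ⟨x, mem_dyadicInter.mpr fun k i hk => ?_⟩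
    simpa [hk] using hx k (hn k (by simp [hk]))

/-! ### Closed sets with countable complement: clopen sets and retractions -/

theorem Set.Countable.exists_between_forall_ne {X : Type*} {Y : Set X} (hY : Y.Countable)
    (g : X → ℝ) {a b : ℝ} (hab : a < b) : ∃ c, a < c ∧ c < b ∧ ∀ y ∈ Y, g y ≠ c := by
  obtain ⟨c, hc, hac, hcb⟩ := ((hY.image g).dense_compl ℝ).exists_between hab
  exact ⟨c, hac, hcb, fun y hy h => hc ⟨y, hy, h⟩⟩

/-- Balls around `x` whose radius is not the distance from `x` to a point of `W` are clopen. -/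
theorem Set.Countable.exists_isClopen_subset {X : Type*} [MetricSpace X] {W : Set X}
    (hW : W.Countable) (hWo : IsOpen W) {x : X} (hx : x ∈ W) :
    ∃ E, IsClopen E ∧ x ∈ E ∧ E ⊆ W := by
  obtain ⟨ε, hε, hball⟩ := Metric.isOpen_iff.mp hWo x hx
  obtain ⟨c, hc0, hcε, hc⟩ := hW.exists_between_forall_ne (dist · x) hε
  have heq : Metric.ball x c = Metric.closedBall x c := by
    refine subset_antisymm Metric.ball_subset_closedBall fun z hz => ?_
    have hzW : z ∈ W := hball (Metric.closedBall_subset_ball hcε hz)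
    exact Metric.mem_ball.mpr (lt_of_le_of_ne (Metric.mem_closedBall.mp hz) (hc z hzW))
  exact ⟨Metric.ball x c, ⟨heq ▸ Metric.isClosed_closedBall, Metric.isOpen_ball⟩,
    Metric.mem_ball_self hc0, (Metric.ball_subset_ball hcε.le).trans hball⟩

theorem exists_isClopen_infDist_lt {X : Type*} [MetricSpace X] {P : Set X}
    (hP : Pᶜ.Countable) {δ : ℝ} (hδ : 0 < δ) :
    ∃ G, IsClopen G ∧ P ⊆ G ∧ ∀ x ∈ G, Metric.infDist x P < δ := by
  obtain ⟨c, hc0, hcδ, hc⟩ := hP.exists_between_forall_ne (Metric.infDist · P) hδ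
  have hcont : Continuous fun x => Metric.infDist x P := Metric.continuous_infDist_pt P
  have heq : {x | Metric.infDist x P < c} = {x | Metric.infDist x P ≤ c} := by
    ext x
    refine ⟨fun h => le_of_lt (show Metric.infDist x P < c from h), fun h => ?_⟩
    by_cases hx : x ∈ P
    · show Metric.infDist x P < c
      rwa [Metric.infDist_zero_of_mem hx]
    · exact lt_of_le_of_ne (show Metric.infDist x P ≤ c from h) (hc x hx)
  refine ⟨{x | Metric.infDist x P < c}, ⟨heq ▸ isClosed_le hcont continuous_const,
    isOpen_lt hcont continuous_const⟩, fun x hx => ?_, fun x hx => lt_trans hx hcδ⟩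
  show Metric.infDist x P < c
  rwa [Metric.infDist_zero_of_mem hx]

/-- A non-empty closed set with countable complement is a retract, under a retraction that moves
no point by more than four times its distance to the set. The complement is partitioned into clopen
pieces that are small in comparison with their distance to `P`, and each piece is sent to a single
nearby point of `P`. -/
theorem exists_retraction {X : Type*} [MetricSpace X] {P : Set X} (hPc : IsClosed P)
    (hPn : P.Nonempty) (hP : Pᶜ.Countable) :
    ∃ r : X → P, Continuous r ∧ (∀ x : P, r x = x) ∧
      ∀ x : X, dist x (r x) ≤ 4 * Metric.infDist x P := by
  rcases Pᶜ.eq_empty_or_nonempty with hY | hY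
  · rw [compl_empty_iff] at hY
    subst hY
    exact ⟨fun x => ⟨x, mem_univ x⟩, by fun_prop, fun x => rfl, fun x => by
      simpa using Metric.infDist_nonneg⟩
  obtain ⟨g, hg⟩ := hP.exists_eq_range hY
  have hgP : ∀ n, g n ∉ P := fun n => show g n ∈ Pᶜ from hg ▸ mem_range_self n
  have hpos : ∀ n, 0 < Metric.infDist (g n) P := fun n =>
    (hPc.notMem_iff_infDist_pos hPn).mp (hgP n)
  have hE : ∀ n, ∃ E, IsClopen E ∧ g n ∈ E ∧
      E ⊆ Pᶜ ∩ Metric.ball (g n) (Metric.infDist (g n) P / 4) := fun n =>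
    (hP.mono inter_subset_left).exists_isClopen_subset
      (hPc.isOpen_compl.inter Metric.isOpen_ball)
      ⟨hgP n, Metric.mem_ball_self (by linarith [hpos n])⟩
  choose E hEc hgE hEs using hE
  have hp : ∀ n, ∃ p ∈ P, dist (g n) p < 2 * Metric.infDist (g n) P := fun n =>
    (Metric.infDist_lt_iff hPn).mp (by linarith [hpos n])
  choose p hpP hp using hp
  have hN : ∀ x, x ∉ P → ∃ n, x ∈ disjointed E n := fun x hx => by
    have hx : x ∈ Pᶜ := hx
    obtain ⟨n, rfl⟩ := hg ▸ hx
    rw [← mem_iUnion, iUnion_disjointed]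
    exact mem_iUnion.mpr ⟨n, hgE n⟩
  choose! N hN using hN
  have hopen : ∀ n, IsOpen (disjointed E n) := fun n =>
    (disjointedRec (fun _ i h => IsClopen.diff h (hEc i)) (hEc n) : IsClopen (disjointed E n)).isOpen
  classical
  let r : X → P := fun x => if h : x ∈ P then ⟨x, h⟩ else ⟨p (N x), hpP _⟩
  have hrP : ∀ x (h : x ∈ P), r x = ⟨x, h⟩ := fun x h => dif_pos h
  have hrY : ∀ x, x ∉ P → r x = ⟨p (N x), hpP _⟩ := fun x h => dif_neg h
  have hdist : ∀ x : X, dist x (r x) ≤ 4 * Metric.infDist x P := by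
    intro x
    by_cases hx : x ∈ P
    · rw [hrP x hx, dist_self]
      exact mul_nonneg (by norm_num) Metric.infDist_nonneg
    · rw [hrY x hx]
      have h1 : dist x (g (N x)) < _ :=
        Metric.mem_ball.mp (hEs _ (disjointed_subset E _ (hN x hx))).2
      have h2 := hp (N x)
      have h3 : Metric.infDist (g (N x)) P ≤ Metric.infDist x P + dist (g (N x)) x :=
        Metric.infDist_le_infDist_add_dist
      have h4 := dist_triangle x (g (N x)) (p (N x))
      rw [dist_comm (g (N x)) x] at h3
      show dist x (p (N x)) ≤ _
      linarith [hpos (N x)]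
  refine ⟨r, continuous_iff_continuousAt.mpr fun x => ?_, fun x => hrP x x.2, hdist⟩
  by_cases hx : x ∈ P
  · rw [Metric.continuousAt_iff]
    intro ε hε
    refine ⟨ε / 5, by linarith, fun z hz => ?_⟩
    rw [hrP x hx, Subtype.dist_eq]
    have h1 := dist_triangle_left (r z : X) x z
    have h2 : Metric.infDist z P ≤ dist z x := Metric.infDist_le_dist_of_mem hx
    have h3 := hdist z
    show dist (r z : X) x < ε
    linarith
  · refine (continuousAt_const (y := r x)).congr ?_
    filter_upwards [(hopen (N x)).mem_nhds (hN x hx)] with z hz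
    have hzP : z ∉ P := (hEs _ (disjointed_subset E _ hz)).1
    have hNz : N z = N x := by
      by_contra hne
      exact disjoint_left.mp (disjoint_disjointed E hne) (hN z hzP) hz
    rw [hrY x hx, hrY z hzP]
    simp only [hNz]

/-- A sequence of clopen sets that contains a base of the open set `Pᶜ` and the complements of
arbitrarily close neighbourhoods of `P`. -/
theorem exists_clopen_sequence {X : Type*} [MetricSpace X] [SecondCountableTopology X] {P : Set X}
    (hPc : IsClosed P) (hP : Pᶜ.Countable) (hY : Pᶜ.Nonempty) :
    ∃ D : ℕ → Set X, (∀ n, IsClopen (D n)) ∧ (∀ n, (D n).Nonempty) ∧ (∀ n, D n ⊆ Pᶜ) ∧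
      (∀ x ∉ P, ∀ V, IsOpen V → x ∈ V → ∃ n, x ∈ D n ∧ D n ⊆ V) ∧
      ∀ δ > 0, (∀ x, Metric.infDist x P < δ) ∨ ∃ n, ∀ x ∉ D n, Metric.infDist x P < δ := by
  have hB := TopologicalSpace.isBasis_countableBasis X
  let I := {q : X × Set X |
    q ∈ Pᶜ ×ˢ TopologicalSpace.countableBasis X ∧ q.1 ∈ q.2}
  have hI : I.Countable := (hP.prod (TopologicalSpace.countable_countableBasis X)).mono
    fun q hq => hq.1
  have hE : ∀ q ∈ I, ∃ E, IsClopen E ∧ q.1 ∈ E ∧ E ⊆ Pᶜ ∩ q.2 := fun q hq =>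
    (hP.mono inter_subset_left).exists_isClopen_subset
      (hPc.isOpen_compl.inter (hB.isOpen hq.1.2)) ⟨hq.1.1, hq.2⟩
  choose! E hEc hEm hEs using hE
  have hG : ∀ m : ℕ, ∃ G, IsClopen G ∧ P ⊆ G ∧ ∀ x ∈ G, Metric.infDist x P < 1 / ((m : ℝ) + 1) :=
    fun m => exists_isClopen_infDist_lt hP Nat.one_div_pos_of_nat
  choose G hGc hPG hG using hG
  let ℬ : Set (Set X) := {D | D ∈ E '' I ∪ range (fun m => (G m)ᶜ) ∧ D.Nonempty}
  have hℬ : ∀ D ∈ ℬ, IsClopen D ∧ D ⊆ Pᶜ := by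
    rintro _ ⟨⟨q, hq, rfl⟩ | ⟨m, rfl⟩, -⟩
    · exact ⟨hEc q hq, (hEs q hq).trans inter_subset_left⟩
    · exact ⟨(hGc m).compl, compl_subset_compl.mpr (hPG m)⟩
  have hbase : ∀ x ∉ P, ∀ V, IsOpen V → x ∈ V → ∃ D ∈ ℬ, x ∈ D ∧ D ⊆ V := by
    intro x hx V hV hxV
    obtain ⟨B, hBb, hxB, hBV⟩ := hB.exists_subset_of_mem_open hxV hV
    have hq : (x, B) ∈ I := ⟨⟨hx, hBb⟩, hxB⟩
    exact ⟨E (x, B), ⟨Or.inl ⟨_, hq, rfl⟩, x, hEm _ hq⟩, hEm _ hq,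
      (hEs _ hq).trans (inter_subset_right.trans hBV)⟩
  obtain ⟨y, hy⟩ := hY
  obtain ⟨D₀, hD₀, -⟩ := hbase y hy univ isOpen_univ (mem_univ y)
  have hcount : ℬ.Countable := ((hI.image E).union (countable_range _)).mono fun D hD => hD.1
  obtain ⟨D, hD⟩ := hcount.exists_eq_range ⟨D₀, hD₀⟩
  have hmem : ∀ n, D n ∈ ℬ := fun n => hD ▸ mem_range_self n
  refine ⟨D, fun n => (hℬ _ (hmem n)).1, fun n => (hmem n).2, fun n => (hℬ _ (hmem n)).2,
    fun x hx V hV hxV => ?_, fun δ hδ => ?_⟩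
  · obtain ⟨_, hD', h⟩ := hbase x hx V hV hxV
    obtain ⟨n, rfl⟩ := hD ▸ hD'
    exact ⟨n, h⟩
  · obtain ⟨m, hm⟩ := exists_nat_one_div_lt hδ
    rcases ((G m)ᶜ).eq_empty_or_nonempty with h | h
    · exact Or.inl fun x => (hG m x (compl_empty_iff.mp h ▸ mem_univ x)).trans hm
    · have hD' : (G m)ᶜ ∈ ℬ := ⟨Or.inr ⟨m, rfl⟩, h⟩
      obtain ⟨n, hn⟩ := hD ▸ hD'
      refine Or.inr ⟨n, fun x hx => (hG m x ?_).trans hm⟩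
      rw [hn] at hx
      exact not_not.mp hx

/-! ### Assembling the subbase -/

/-- A sequence of exterior pairs of half-clopen sets that is proper, and that generates the
neighbourhoods of the points of `P` once neighbourhoods of the whole set `P` are available. -/
structure IsSubbaseAlong {X : Type*} [MetricSpace X] (P : Set X) (S : ℕ → Fin 2 → Set X) :
    Prop where
  pair : ∀ n, IsExteriorPair (S n)
  frontier_subset : ∀ n i, frontier (S n i) ⊆ P
  mem_closure : ∀ σ : TernarySeq, σ.dom.Finite → ∀ x,
    (∀ k i, σ k = some i → x ∈ closure (S k i)) → x ∈ closure (dyadicInter S σ)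
  exists_open : ∀ x ∈ P, ∀ V, IsOpen V → x ∈ V →
    ∃ W, IsOpen[TopologicalSpace.generateFrom {G | ∃ n i, G = S n i}] W ∧ x ∈ W ∧
      ∃ δ > 0, ∀ y ∈ W, Metric.infDist y P < δ → y ∈ V

theorem isOpen_dyadicInter {X : Type*} [TopologicalSpace X] {S : ℕ → Fin 2 → Set X}
    (hS : ∀ n i, IsOpen (S n i)) {σ : TernarySeq} (hσ : σ.dom.Finite) :
    IsOpen (dyadicInter S σ) := by
  have : dyadicInter S σ = ⋂ k ∈ σ.dom, ⋂ (i : Fin 2) (_ : σ k = some i), S k i := by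
    ext x
    simp only [mem_dyadicInter, mem_iInter]
    refine forall_congr' fun k => ⟨fun h _ => h, fun h i hk => h ?_ i hk⟩
    simp [TernarySeq.dom, hk]
  rw [this]
  exact hσ.isOpen_biInter fun k _ => isOpen_iInter_of_finite fun i =>
    isOpen_iInter_of_finite fun _ => hS k i

/-- Inverse images, under a retraction `r` onto `P`, of a proper dyadic subbase of `P` none of
whose members has a boundary point in `r '' Pᶜ`. -/
theorem isSubbaseAlong_preimage {X : Type*} [MetricSpace X] {P : Set X} {r : X → P}
    (hr : Continuous r) (hrP : ∀ x : P, r x = x)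
    (hdist : ∀ x : X, dist x (r x) ≤ 4 * Metric.infDist x P)
    {T : ℕ → Fin 2 → Set P} (hT : IsProperDyadicSubbase T) (hpair : ∀ n, IsExteriorPair (T n))
    (hfr : ∀ n i, ∀ x ∈ r '' Pᶜ, x ∉ frontier (T n i)) :
    IsSubbaseAlong P fun n i => r ⁻¹' T n i := by
  have hmem : ∀ n i x, x ∉ P → r x ∈ closure (T n i) → r x ∈ T n i := by
    intro n i x hx h
    by_contra hn
    refine hfr n i (r x) ⟨x, hx, rfl⟩ ?_
    rw [((hpair n).isOpen i).frontier_eq]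
    exact ⟨h, hn⟩
  have himage : ∀ (A : Set P) (x : X), x ∈ P → r x ∈ closure A → x ∈ closure (r ⁻¹' A) := by
    intro A x hx h
    have h1 := image_closure_subset_closure_image continuous_subtype_val (mem_image_of_mem _ h)
    rw [show r x = ⟨x, hx⟩ from hrP ⟨x, hx⟩] at h1
    refine closure_mono ?_ h1
    rintro _ ⟨y, hy, rfl⟩
    rwa [mem_preimage, hrP y]
  have hcl : ∀ n i, closure (r ⁻¹' T n i) = r ⁻¹' closure (T n i) := by
    refine fun n i => subset_antisymm (hr.closure_preimage_subset _) fun x hx => ?_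
    by_cases hxP : x ∈ P
    · exact himage _ x hxP hx
    · exact subset_closure (hmem n i x hxP hx)
  refine ⟨fun n => ⟨?_, ?_⟩, fun n i x hx => ?_, fun σ hσ x hx => ?_, fun x hx V hV hxV => ?_⟩
  · rw [hcl, (hpair n).one_eq, preimage_compl]
  · rw [hcl, (hpair n).zero_eq, preimage_compl]
  · rw [(((hpair n).isOpen i).preimage hr).frontier_eq, hcl] at hx
    by_contra hxP
    exact hx.2 (hmem n i x hxP hx.1)
  · simp only [hcl] at hx
    by_cases hxP : x ∈ P
    · have h : r x ∈ closure (dyadicInter T σ) :=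
        (hT.proper σ hσ).symm ▸ mem_dyadicInter.mpr hx
      refine closure_mono (fun y hy => ?_) (himage _ x hxP h)
      exact mem_dyadicInter.mpr fun k i hk => mem_dyadicInter.mp hy k i hk
    · exact subset_closure (mem_dyadicInter.mpr fun k i hk => hmem k i x hxP (hx k i hk))
  · obtain ⟨ε, hε, hball⟩ := Metric.isOpen_iff.mp hV x hxV
    refine ⟨r ⁻¹' Metric.ball ⟨x, hx⟩ (ε / 2), ?_, ?_, ε / 8, by linarith, fun y hy hyδ => ?_⟩
    · have hcont : @Continuous X P
          (TopologicalSpace.generateFrom {G | ∃ n i, G = r ⁻¹' T n i}) _ r := by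
        rw [hT.subbase, continuous_generateFrom_iff]
        rintro _ ⟨n, i, rfl⟩
        exact TopologicalSpace.isOpen_generateFrom_of_mem ⟨n, i, rfl⟩
      exact @IsOpen.preimage _ _ (_) _ _ hcont _ Metric.isOpen_ball
    · rw [mem_preimage, show r x = ⟨x, hx⟩ from hrP ⟨x, hx⟩]
      exact Metric.mem_ball_self (by linarith)
    · have h1 : dist (r y : X) x < ε / 2 := hy
      refine hball (Metric.mem_ball.mpr ?_)
      linarith [hdist y, dist_triangle y (r y : X) x]

/-- The sequence `S` at the even places, the clopen pairs `D n`, `(D n)ᶜ` at the odd places. -/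
def interleaveClopen {X : Type*} (S : ℕ → Fin 2 → Set X) (D : ℕ → Set X) : ℕ → Fin 2 → Set X :=
  fun m => Sum.elim S (fun n => ![D n, (D n)ᶜ]) (Equiv.natSumNatEquivNat.symm m)

section interleaveClopen

variable {X : Type*} (S : ℕ → Fin 2 → Set X) (D : ℕ → Set X)

theorem interleaveClopen_even (n : ℕ) : interleaveClopen S D (2 * n) = S n := by
  rw [interleaveClopen, ← show Equiv.natSumNatEquivNat (Sum.inl n) = 2 * n by simp,
    Equiv.symm_apply_apply, Sum.elim_inl]

theorem interleaveClopen_odd (n : ℕ) : interleaveClopen S D (2 * n + 1) = ![D n, (D n)ᶜ] := by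
  rw [interleaveClopen, ← show Equiv.natSumNatEquivNat (Sum.inr n) = 2 * n + 1 by simp,
    Equiv.symm_apply_apply, Sum.elim_inr]

theorem forall_even_odd {p : ℕ → Prop} (h0 : ∀ n, p (2 * n)) (h1 : ∀ n, p (2 * n + 1)) (n : ℕ) :
    p n := by
  rcases Nat.even_or_odd' n with ⟨m, rfl | rfl⟩
  exacts [h0 m, h1 m]

theorem dyadicInter_interleaveClopen (σ : TernarySeq) :
    dyadicInter (interleaveClopen S D) σ = dyadicInter S (fun n => σ (2 * n)) ∩
      dyadicInter (fun n => ![D n, (D n)ᶜ]) (fun n => σ (2 * n + 1)) := by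
  ext x
  simp only [mem_inter_iff, mem_dyadicInter]
  refine ⟨fun h => ⟨fun k i hk => ?_, fun k i hk => ?_⟩, fun h => forall_even_odd ?_ ?_⟩
  · rw [← interleaveClopen_even S D]; exact h _ i hk
  · rw [← interleaveClopen_odd S D]; exact h _ i hk
  · intro n i hk
    rw [interleaveClopen_even]; exact h.1 n i hk
  · intro n i hk
    rw [interleaveClopen_odd]; exact h.2 n i hk

end interleaveClopen

theorem IsClopen.isClopen_pair {X : Type*} [TopologicalSpace X] {D : Set X} (hD : IsClopen D)
    (i : Fin 2) : IsClopen ((![D, Dᶜ] : Fin 2 → Set X) i) := by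
  fin_cases i
  exacts [hD, hD.compl]

theorem IsClopen.isExteriorPair {X : Type*} [TopologicalSpace X] {D : Set X} (hD : IsClopen D) :
    IsExteriorPair (![D, Dᶜ] : Fin 2 → Set X) where
  one_eq := by simp [hD.isClosed.closure_eq]
  zero_eq := by simp [hD.compl.isClosed.closure_eq]

namespace IsSubbaseAlong

variable {X : Type*} [MetricSpace X] {P : Set X} {S : ℕ → Fin 2 → Set X}

theorem isProperDyadicSubbase_of_eq_univ (hS : IsSubbaseAlong P S) (hP : P = univ) :
    IsProperDyadicSubbase S := by
  refine isProperDyadicSubbase_of_mem_closure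
    (isDyadicSubbase_of_exterior hS.pair fun x V hV hxV => ?_) hS.mem_closure
  obtain ⟨W, hW, hxW, δ, hδ, h⟩ := hS.exists_open x (hP ▸ mem_univ x) V hV hxV
  refine ⟨W, hW, hxW, fun y hy => h y hy ?_⟩
  rwa [Metric.infDist_zero_of_mem (hP ▸ mem_univ y)]

theorem isExteriorPair_interleaveClopen (hS : IsSubbaseAlong P S) {D : ℕ → Set X}
    (hD : ∀ n, IsClopen (D n)) (n : ℕ) : IsExteriorPair (interleaveClopen S D n) := by
  induction n using forall_even_odd with
  | h0 n => rw [interleaveClopen_even]; exact hS.pair n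
  | h1 n => rw [interleaveClopen_odd]; exact (hD n).isExteriorPair

theorem isHalfClopen_interleaveClopen (hS : IsSubbaseAlong P S) {D : ℕ → Set X}
    (hD : ∀ n, IsClopen (D n)) (n : ℕ) (i : Fin 2) : IsHalfClopen P (interleaveClopen S D n i) := by
  refine (hS.isExteriorPair_interleaveClopen hD n).isHalfClopen (fun i => ?_) i
  induction n using forall_even_odd with
  | h0 n => rw [interleaveClopen_even]; exact hS.frontier_subset n i
  | h1 n =>
    rw [interleaveClopen_odd, ((hD n).isClopen_pair i).frontier_eq]
    exact empty_subset P

theorem isProperDyadicSubbase_interleaveClopen (hS : IsSubbaseAlong P S) {D : ℕ → Set X}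
    (hD : ∀ n, IsClopen (D n))
    (hbase : ∀ x ∉ P, ∀ V, IsOpen V → x ∈ V → ∃ n, x ∈ D n ∧ D n ⊆ V)
    (hnhds : ∀ δ > 0, (∀ x, Metric.infDist x P < δ) ∨ ∃ n, ∀ x ∉ D n, Metric.infDist x P < δ)
    (hDP : ∀ n, D n ⊆ Pᶜ) :
    IsProperDyadicSubbase (interleaveClopen S D) := by
  have hD0 : ∀ n, interleaveClopen S D (2 * n + 1) 0 = D n := fun n => by
    rw [interleaveClopen_odd]; rfl
  have hD1 : ∀ n, interleaveClopen S D (2 * n + 1) 1 = (D n)ᶜ := fun n => by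
    rw [interleaveClopen_odd]; rfl
  refine isProperDyadicSubbase_of_mem_closure (isDyadicSubbase_of_exterior
    (hS.isExteriorPair_interleaveClopen hD) fun x V hV hxV => ?_) fun σ hσ x hx => ?_
  · by_cases hxP : x ∈ P
    · obtain ⟨W, hW, hxW, δ, hδ, h⟩ := hS.exists_open x hxP V hV hxV
      have hW' : IsOpen[TopologicalSpace.generateFrom
          {G | ∃ n i, G = interleaveClopen S D n i}] W := by
        refine TopologicalSpace.generateFrom_anti ?_ W hW
        rintro _ ⟨n, i, rfl⟩
        exact ⟨2 * n, i, by rw [interleaveClopen_even]⟩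
      rcases hnhds δ hδ with hall | ⟨n, hn⟩
      · exact ⟨W, hW', hxW, fun y hy => h y hy (hall y)⟩
      · refine ⟨W ∩ (D n)ᶜ, @TopologicalSpace.isOpen_inter _ (_) _ _ hW' ?_,
          ⟨hxW, fun hxD => hDP n hxD hxP⟩, fun y hy => h y hy.1 (hn y hy.2)⟩
        rw [← hD1 n]
        exact isOpen_generateFrom_pairs _ _ _
    · obtain ⟨n, hxn, hn⟩ := hbase x hxP V hV hxV
      exact ⟨D n, hD0 n ▸ isOpen_generateFrom_pairs _ _ _, hxn, hn⟩
  · have h0 : TernarySeq.dom (fun n => σ (2 * n)) |>.Finite :=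
      hσ.preimage (f := fun n => 2 * n) fun a _ b _ h => by simpa using h
    have h1 : TernarySeq.dom (fun n => σ (2 * n + 1)) |>.Finite :=
      hσ.preimage (f := fun n => 2 * n + 1) fun a _ b _ h => by simpa using h
    rw [dyadicInter_interleaveClopen, inter_comm]
    -- The intersection over the odd places is an open neighbourhood of `x`.
    refine (isOpen_dyadicInter (fun n i => ((hD n).isClopen_pair i).isOpen)
      h1).inter_closure ⟨mem_dyadicInter.mpr fun k i hk => ?_, hS.mem_closure _ h0 x
        fun k i hk => ?_⟩
    · have := hx _ i hk
      rwa [interleaveClopen_odd, ((hD k).isClopen_pair i).isClosed.closure_eq] at this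
    · have := hx _ i hk
      rwa [interleaveClopen_even] at this

end IsSubbaseAlong

theorem isSubbaseAlong_empty {X : Type*} [MetricSpace X] :
    IsSubbaseAlong (∅ : Set X) fun _ => ![∅, ∅ᶜ] where
  pair _ := isClopen_empty.isExteriorPair
  frontier_subset _ i := by rw [(isClopen_empty.isClopen_pair i).frontier_eq]
  mem_closure σ _ x hx := subset_closure (mem_dyadicInter.mpr fun k i hk => by
    simpa only [(isClopen_empty.isClopen_pair i).isClosed.closure_eq] using hx k i hk)
  exists_open x hx := absurd hx (notMem_empty x)

theorem isCantorBendixsonSet_perfectKernel (X : Type*) [TopologicalSpace X]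
    [SecondCountableTopology X] :
    IsCantorBendixsonSet (CantorBendixson.perfectKernel (univ : Set X)) where
  perfect := CantorBendixson.perfect_perfectKernel isClosed_univ
  countable_compl := by
    obtain ⟨V, D, hV, hD, huniv⟩ :=
      exists_countable_union_perfect_of_isClosed (isClosed_univ (X := X))
    refine hV.mono fun x hx => ?_
    rcases huniv ▸ mem_univ x with h | h
    · exact h
    · exact absurd (hD.subset_perfectKernel (subset_univ D) h) hx

theorem Preperfect.perfectSpace {X : Type*} [TopologicalSpace X] {P : Set X} (hP : Preperfect P) :
    PerfectSpace P where
  univ_preperfect := by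
    refine preperfect_iff_nhds.mpr fun x _ U hU => ?_
    obtain ⟨V, hV, hVU⟩ := mem_nhds_subtype P x U |>.mp hU
    obtain ⟨y, ⟨hyV, hyP⟩, hne⟩ := preperfect_iff_nhds.mp hP x x.2 V hV
    exact ⟨⟨y, hyP⟩, ⟨hVU hyV, mem_univ _⟩, fun h => hne (congrArg Subtype.val h)⟩

theorem theorem1 {X : Type*} [MetricSpace X] [TopologicalSpace.SeparableSpace X] :
    IsCantorBendixsonSet (CantorBendixson.perfectKernel (Set.univ : Set X)) ∧
    ∀ P : Set X, IsCantorBendixsonSet P →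
      ∃ S : ℕ → Fin 2 → Set X,
        IsProperDyadicSubbase S ∧
        (∀ n i, IsHalfClopen P (S n i)) ∧
        (P.Nonempty →
          ∃ e : ℕ → ℕ, StrictMono e ∧
            IsIndependentSubbase (fun n i => ((↑) : P → X) ⁻¹' (S (e n) i)) ∧
            ∀ n, n ∉ Set.range e → (S n 0).Nonempty ∧ S n 0 ∩ P = ∅ ∧ P ⊆ S n 1) := by
  have : SecondCountableTopology X := UniformSpace.secondCountable_of_separable X
  refine ⟨isCantorBendixsonSet_perfectKernel X, fun P hP => ?_⟩
  have hPc := hP.perfect.closed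
  obtain ⟨S, hS, hindep⟩ : ∃ S : ℕ → Fin 2 → Set X, IsSubbaseAlong P S ∧
      (P.Nonempty → IsIndependentSubbase fun n i => ((↑) : P → X) ⁻¹' S n i) := by
    rcases P.eq_empty_or_nonempty with rfl | hPn
    · exact ⟨_, isSubbaseAlong_empty, fun h => absurd h not_nonempty_empty⟩
    · have := hP.perfect.acc.perfectSpace
      have := hPn.to_subtype
      obtain ⟨r, hr, hrP, hdist⟩ := exists_retraction hPc hPn hP.countable_compl
      obtain ⟨T, hpair, hT, hindep, hfr⟩ := exists_proper_independent (hP.countable_compl.image r)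
      refine ⟨_, isSubbaseAlong_preimage hr hrP hdist hT hpair hfr, fun _ => ?_⟩
      have heq : ∀ A : Set P, ((↑) : P → X) ⁻¹' (r ⁻¹' A) = A := fun A => by
        ext x
        rw [mem_preimage, mem_preimage, hrP x]
      simpa only [heq] using hindep
  rcases Pᶜ.eq_empty_or_nonempty with hY | hY
  · refine ⟨S, hS.isProperDyadicSubbase_of_eq_univ (compl_empty_iff.mp hY),
      fun n => (hS.pair n).isHalfClopen (hS.frontier_subset n),
      fun hPn => ⟨id, strictMono_id, hindep hPn, fun n hn => absurd ⟨n, rfl⟩ hn⟩⟩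
  · obtain ⟨D, hD, hDn, hDP, hbase, hnhds⟩ := exists_clopen_sequence hPc hP.countable_compl hY
    refine ⟨interleaveClopen S D,
      hS.isProperDyadicSubbase_interleaveClopen hD hbase hnhds hDP,
      hS.isHalfClopen_interleaveClopen hD, fun hPn => ⟨fun n => 2 * n,
        fun a b h => by simpa using h, ?_, ?_⟩⟩
    · simpa only [interleaveClopen_even] using hindep hPn
    · refine forall_even_odd (fun n hn => absurd ⟨n, rfl⟩ hn) fun n _ => ?_
      rw [interleaveClopen_odd]
      refine ⟨hDn n, ?_, ?_⟩
      · exact (disjoint_left.mpr fun x hx hxP => hDP n hx hxP).inter_eq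
      · exact fun x hx hxD => hDP n hxD hx
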